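/- Let $n\ge 1$, let $\mathbb F$ be a field with $2\neq 0$ in $\mathbb F$, and let $q\in\mathbb F^\times$. For $k\ge 0$ put $[k]=q+q^3+\dots+q^{2k-1}$ and, for $k>0$, $[-k]=-(q^{-1}+q^{-3}+\dots+q^{-(2k-1)})$. Assume that $[1],\dots,[n]$ are non-zero and that $-1,[1],\dots,[n]$ have square roots in $\mathbb F$, and fix a choice of these square roots. Let $\mathscr H_n$ be the Iwahori--Hecke algebra of $\mathfrak S_n$: the unital associative $\mathbb F$-algebra with generators $T_1,\dots,T_{n-1}$ and relations $(T_i-q)(T_i+q^{-1})=0$, $T_iT_j=T_jT_i$ for $|i-j|>1$, and $T_iT_{i+1}T_i=T_{i+1}T_iT_{i+1}$. For $w\in\mathfrak S_n$ of Coxeter length $\ell(w)$ put $T_w=T_{i_1}\cdots T_{i_k}$, where $w=s_{i_1}\cdots s_{i_k}$ is a reduced expression in the transpositions $s_i=(i,i+1)$. Let $\#$ be the $\mathbb F$-algebra automorphism of $\mathscr H_n$ with $T_i^\#=-T_i^{-1}$ (so $T_w^\#=(-1)^{\ell(w)}T_{w^{-1}}^{-1}$ for all $w$), let $\mathscr A_n=\{a\in\mathscr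 H_n : a^\#=a\}$ be the alternating Hecke algebra, and for $w\in\mathfrak S_n$ let $A_w=\tfrac12\bigl(T_w+(-1)^{\ell(w)}T_w^\#\bigr)$; if $w$ lies in the alternating group $\mathfrak A_n$ then $A_w\in\mathscr A_n$. For a partition $\lambda$ of $n$ let $S(\lambda)$ be the Specht module in seminormal form: the right $\mathscr H_n$-module with basis $v_{\mathfrak t}$, for $\mathfrak t$ a standard $\lambda$-tableau, and action \[ v_{\mathfrak t}T_i=\frac{-1}{[\rho]}\,v_{\mathfrak t}+\alpha_{\mathfrak t}(i)\,v_{\mathfrak t s_i},\qquad 1\le i<n, \] where $\rho=c_{\mathfrak t}(i)-c_{\mathfrak t}(i+1)$, $c_{\mathfrak t}(k)$ is the content (column minus row) of $k$ in $\mathfrak t$, $\mathfrak t s_i$ is $\mathfrak t$ with $i$ and $i+1$ exchanged, and $\alpha_{\mathfrak t}(i)=\alpha_\rho$ if $\mathfrak t s_i$ is standard and $\alpha_{\mathfrak t}(i)=0$ (the second term being omitted) otherwise; here $\alpha_k=\sqrt{-1}\sqrt{[k+1]}\sqrt{[k-1]}/[k]$ and $\alpha_{-k}=-\alpha_k$ for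 $k>0$. Let $\chi^\lambda$ be the character of $S(\lambda)$, let $\chi^\lambda_{\mathscr A}$ be the character of the restriction of $S(\lambda)$ to $\mathscr A_n$, and let $\lambda'$ be the partition conjugate to $\lambda$. Then, for every partition $\lambda$ of $n$ and every $w\in\mathfrak A_n$, \[ \chi^\lambda_{\mathscr A}(A_w)=\tfrac12\bigl(\chi^\lambda(T_w)+\chi^{\lambda'}(T_w)\bigr). \] -/

import Mathlib

noncomputable section

namespace AltHecke

/-! ### The symmetric group: Coxeter generators, reduced words, length

The symmetric group of degree `n` is `Equiv.Perm (Fin n)`; the numbers `1, …, n` are shifted to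
`0, …, n - 1`, so the generator with index `i : Fin (n - 1)` exchanges `i` and `i + 1`. -/

/-- The point `i` of `Fin n` attached to a generator index. -/
def lo {n : ℕ} (i : Fin (n - 1)) : Fin n := ⟨i.1, by omega⟩

/-- The point `i + 1` of `Fin n` attached to a generator index. -/
def hi {n : ℕ} (i : Fin (n - 1)) : Fin n := ⟨i.1 + 1, by omega⟩

/-- The Coxeter generator `s_i = (i, i+1)`. -/
def s {n : ℕ} (i : Fin (n - 1)) : Equiv.Perm (Fin n) := Equiv.swap (lo i) (hi i)

/-- The product `s_{i₁} ⋯ s_{iₖ}` of a word. -/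
def wordPerm {n : ℕ} (l : List (Fin (n - 1))) : Equiv.Perm (Fin n) := (l.map s).prod

theorem exists_word {n : ℕ} (w : Equiv.Perm (Fin n)) : ∃ l, wordPerm l = w := by
  rcases n with _ | m
  · exact ⟨[], Subsingleton.elim _ _⟩
  · have hw : w ∈ Submonoid.closure
        (Set.range fun i : Fin m ↦ Equiv.swap i.castSucc i.succ) := by
      rw [Equiv.Perm.mclosure_swap_castSucc_succ]; trivial
    obtain ⟨l, hl, rfl⟩ := Submonoid.exists_list_of_mem_closure hw
    clear hw
    induction l with
    | nil => exact ⟨[], rfl⟩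
    | cons a l ih =>
      obtain ⟨l', hl'⟩ := ih fun y hy ↦ hl y (List.mem_cons_of_mem _ hy)
      obtain ⟨i, hi⟩ := hl a List.mem_cons_self
      refine ⟨i :: l', ?_⟩
      rw [List.prod_cons, ← hl', ← hi]
      rfl

/-- The Coxeter length: the least length of a word in the generators with product `w`. -/
def length {n : ℕ} (w : Equiv.Perm (Fin n)) : ℕ :=
  sInf {k | ∃ l : List (Fin (n - 1)), wordPerm l = w ∧ l.length = k}

/-- `l` is a reduced expression for `w`. -/
def IsReducedWord {n : ℕ} (l : List (Fin (n - 1))) (w : Equiv.Perm (Fin n)) : Prop :=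
  wordPerm l = w ∧ l.length = length w

theorem exists_reducedWord {n : ℕ} (w : Equiv.Perm (Fin n)) : ∃ l, IsReducedWord l w := by
  obtain ⟨l, hl⟩ := exists_word w
  exact Nat.sInf_mem (s := {k | ∃ l : List (Fin (n - 1)), wordPerm l = w ∧ l.length = k})
    ⟨_, l, hl, rfl⟩

/-- A reduced expression for `w`. -/
def reducedWord {n : ℕ} (w : Equiv.Perm (Fin n)) : List (Fin (n - 1)) :=
  (exists_reducedWord w).choose

/-! ### The Iwahori--Hecke algebra -/

section Hecke

variable {R : Type*} [CommRing R] (q : Rˣ) (n : ℕ)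

/-- The defining relations of the Iwahori--Hecke algebra of type `A`. -/
inductive HeckeRel : FreeAlgebra R (Fin (n - 1)) → FreeAlgebra R (Fin (n - 1)) → Prop
  | quadratic (i : Fin (n - 1)) :
      HeckeRel
        ((FreeAlgebra.ι R i - algebraMap R _ (q : R)) *
          (FreeAlgebra.ι R i + algebraMap R _ ((q⁻¹ : Rˣ) : R))) 0
  | commute (i j : Fin (n - 1)) (h : i.1 + 1 < j.1) :
      HeckeRel (FreeAlgebra.ι R i * FreeAlgebra.ι R j) (FreeAlgebra.ι R j * FreeAlgebra.ι R i)
  | braid (i j : Fin (n - 1)) (h : i.1 + 1 = j.1) :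
      HeckeRel (FreeAlgebra.ι R i * FreeAlgebra.ι R j * FreeAlgebra.ι R i)
        (FreeAlgebra.ι R j * FreeAlgebra.ι R i * FreeAlgebra.ι R j)

/-- The Iwahori--Hecke algebra of the symmetric group of degree `n` with parameter `q`. -/
def Hecke : Type _ := RingQuot (HeckeRel q n)

instance : Ring (Hecke q n) := inferInstanceAs (Ring (RingQuot (HeckeRel q n)))

instance : Algebra R (Hecke q n) := inferInstanceAs (Algebra R (RingQuot (HeckeRel q n)))

/-- The quotient map from the free algebra. -/
def mk : FreeAlgebra R (Fin (n - 1)) →ₐ[R] Hecke q n := RingQuot.mkAlgHom R (HeckeRel q n)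

variable {n}

/-- The generator `T_i`. -/
def gen (i : Fin (n - 1)) : Hecke q n := mk q n (FreeAlgebra.ι R i)

theorem mk_rel {x y : FreeAlgebra R (Fin (n - 1))} (h : HeckeRel q n x y) : mk q n x = mk q n y :=
  RingQuot.mkAlgHom_rel R h

/-- The element `T_{i₁} ⋯ T_{iₖ}` of a word. -/
def wordT (l : List (Fin (n - 1))) : Hecke q n := (l.map (gen q)).prod

/-- The standard basis element `T_w`, the product of the generators along a reduced expression of
`w` (it does not depend on which one). -/
def T (w : Equiv.Perm (Fin n)) : Hecke q n := wordT q (reducedWord w)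

theorem gen_quadratic (i : Fin (n - 1)) :
    (gen q i - algebraMap R _ (q : R)) * (gen q i + algebraMap R _ ((q⁻¹ : Rˣ) : R)) = 0 := by
  simpa [gen] using mk_rel q (HeckeRel.quadratic (q := q) i)

theorem gen_commute (i j : Fin (n - 1)) (h : i.1 + 1 < j.1) :
    gen q i * gen q j = gen q j * gen q i := by
  simpa [gen] using mk_rel q (HeckeRel.commute (q := q) i j h)

theorem gen_braid (i j : Fin (n - 1)) (h : i.1 + 1 = j.1) :
    gen q i * gen q j * gen q i = gen q j * gen q i * gen q j := by
  simpa [gen] using mk_rel q (HeckeRel.braid (q := q) i j h)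

/-- The universal property of the presentation. -/
def lift {B : Type*} [Ring B] [Algebra R B] (f : Fin (n - 1) → B)
    (hquad : ∀ i, (f i - algebraMap R B (q : R)) * (f i + algebraMap R B ((q⁻¹ : Rˣ) : R)) = 0)
    (hcomm : ∀ i j : Fin (n - 1), i.1 + 1 < j.1 → f i * f j = f j * f i)
    (hbraid : ∀ i j : Fin (n - 1), i.1 + 1 = j.1 → f i * f j * f i = f j * f i * f j) :
    Hecke q n →ₐ[R] B :=
  RingQuot.liftAlgHom R ⟨FreeAlgebra.lift R f, by
    intro x y h
    cases h with
    | quadratic i => simpa using hquad i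
    | commute i j h => simpa using hcomm i j h
    | braid i j h => simpa using hbraid i j h⟩

theorem lift_gen {B : Type*} [Ring B] [Algebra R B] (f : Fin (n - 1) → B)
    (hquad : ∀ i, (f i - algebraMap R B (q : R)) * (f i + algebraMap R B ((q⁻¹ : Rˣ) : R)) = 0)
    (hcomm : ∀ i j : Fin (n - 1), i.1 + 1 < j.1 → f i * f j = f j * f i)
    (hbraid : ∀ i j : Fin (n - 1), i.1 + 1 = j.1 → f i * f j * f i = f j * f i * f j)
    (i : Fin (n - 1)) : lift q f hquad hcomm hbraid (gen q i) = f i := by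
  have h := RingQuot.liftAlgHom_mkAlgHom_apply (S := R) (s := HeckeRel q n) (FreeAlgebra.lift R f)
    (by
      intro x y h
      cases h with
      | quadratic i => simpa using hquad i
      | commute i j h => simpa using hcomm i j h
      | braid i j h => simpa using hbraid i j h) (FreeAlgebra.ι R i)
  rw [FreeAlgebra.lift_ι_apply] at h
  exact h

theorem algHom_ext_gen {B : Type*} [Ring B] [Algebra R B] {f g : Hecke q n →ₐ[R] B}
    (h : ∀ i, f (gen q i) = g (gen q i)) : f = g := by
  apply RingQuot.ringQuot_ext' R f g
  apply FreeAlgebra.hom_ext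
  funext i
  exact h i

theorem gen_sq (i : Fin (n - 1)) :
    gen q i * gen q i = ((q : R) - ((q⁻¹ : Rˣ) : R)) • gen q i + 1 := by
  have h := gen_quadratic q i
  rw [sub_mul, mul_add, mul_add, ← map_mul, Units.mul_inv, map_one, ← Algebra.commutes,
    ← Algebra.smul_def, ← Algebra.smul_def] at h
  rw [sub_smul, ← sub_eq_zero, ← h]
  abel

/-- The element `-T_i + q - q⁻¹`, which is `-T_i⁻¹`. -/
def hashGen (i : Fin (n - 1)) : Hecke q n :=
  ((q : R) - ((q⁻¹ : Rˣ) : R)) • 1 - gen q i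

theorem hashGen_mul_gen (i : Fin (n - 1)) : hashGen q i * gen q i = -1 := by
  rw [hashGen, sub_mul, gen_sq, smul_mul_assoc, one_mul]; abel

theorem gen_mul_hashGen (i : Fin (n - 1)) : gen q i * hashGen q i = -1 := by
  rw [hashGen, mul_sub, gen_sq, mul_smul_comm, mul_one]; abel

theorem hash_braid_aux {A : Type*} [Ring A] [Algebra R A] (h : R) (a b : A)
    (ha : a * a = h • a + 1) (hb : b * b = h • b + 1) (hab : a * b * a = b * a * b) :
    (h • 1 - a) * (h • 1 - b) * (h • 1 - a) = (h • 1 - b) * (h • 1 - a) * (h • 1 - b) := by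
  simp only [sub_mul, mul_sub, smul_mul_assoc, mul_smul_comm, one_mul, mul_one, ha, hb, hab,
    smul_sub, smul_add]
  module

/-- The algebra endomorphism underlying `#`. -/
def hashHom : Hecke q n →ₐ[R] Hecke q n :=
  lift q (hashGen q)
    (by
      intro i
      have h := gen_quadratic q i
      have h' : (gen q i + algebraMap R _ ((q⁻¹ : Rˣ) : R)) * (gen q i - algebraMap R _ (q : R))
          = 0 := by
        rw [← h]
        have c1 := Algebra.commutes (q : R) (gen q i)
        have c2 := Algebra.commutes ((q⁻¹ : Rˣ) : R) (gen q i)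
        have c3 := Algebra.commutes (A := Hecke q n) (q : R)
          (algebraMap R _ ((q⁻¹ : Rˣ) : R))
        simp only [sub_mul, mul_sub, add_mul, mul_add, c1, c2, c3]
        abel
      rw [← h', hashGen, ← Algebra.algebraMap_eq_smul_one, map_sub]
      rw [show algebraMap R (Hecke q n) (q : R) - algebraMap R _ ((q⁻¹ : Rˣ) : R) - gen q i
          - algebraMap R _ (q : R) = -(gen q i + algebraMap R _ ((q⁻¹ : Rˣ) : R)) by abel,
        show algebraMap R (Hecke q n) (q : R) - algebraMap R _ ((q⁻¹ : Rˣ) : R) - gen q i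
          + algebraMap R _ ((q⁻¹ : Rˣ) : R) = -(gen q i - algebraMap R _ (q : R)) by abel,
        neg_mul_neg])
    (by
      intro i j h
      have := gen_commute q i j h
      simp only [hashGen, sub_mul, mul_sub, smul_mul_assoc, mul_smul_comm, one_mul, mul_one, this]
      module)
    (by
      intro i j h
      exact hash_braid_aux _ _ _ (gen_sq q i) (gen_sq q j) (gen_braid q i j h))

theorem hashHom_gen (i : Fin (n - 1)) : hashHom q (gen q i) = hashGen q i :=
  lift_gen q _ _ _ _ i

theorem hashHom_hashHom (x : Hecke q n) : hashHom q (hashHom q x) = x := by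
  have : (hashHom q (n := n)).comp (hashHom q) = AlgHom.id R _ := by
    apply algHom_ext_gen
    intro i
    simp [hashHom_gen, hashGen]
  exact congrArg (fun f ↦ f x) this

/-- The automorphism `#` of the Hecke algebra, given on generators by `T_i ↦ -T_i⁻¹`; so
`T_x ↦ (-1)^{ℓ(x)} (T_{x⁻¹})⁻¹` for every `x`, see `hash_wordT`. -/
def hash : Hecke q n ≃ₐ[R] Hecke q n :=
  AlgEquiv.ofAlgHom (hashHom q) (hashHom q)
    (AlgHom.ext (hashHom_hashHom q)) (AlgHom.ext (hashHom_hashHom q))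

theorem hash_hash (x : Hecke q n) : hash q (hash q x) = x := hashHom_hashHom q x

theorem hash_gen (i : Fin (n - 1)) : hash q (gen q i) = hashGen q i := hashHom_gen q i

/-- `(T_{i₁} ⋯ T_{iₖ})^# = (-1)^k (T_{iₖ} ⋯ T_{i₁})⁻¹`. -/
theorem hash_wordT (l : List (Fin (n - 1))) :
    hash q (wordT q l) * wordT q l.reverse = (-1) ^ l.length ∧
      wordT q l.reverse * hash q (wordT q l) = (-1) ^ l.length := by
  induction l with
  | nil => simp [wordT]
  | cons i l ih =>
    have e1 : wordT q (i :: l) = gen q i * wordT q l := by simp [wordT]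
    have e2 : wordT q (i :: l).reverse = wordT q l.reverse * gen q i := by simp [wordT]
    have hc : ∀ (k : ℕ) (x : Hecke q n), (-1) ^ k * x = x * (-1) ^ k := fun k x ↦
      ((Commute.neg_one_left x).pow_left k).eq
    rw [e1, e2, map_mul, hash_gen, List.length_cons]
    constructor
    · calc hashGen q i * hash q (wordT q l) * (wordT q l.reverse * gen q i)
          = hashGen q i * ((hash q (wordT q l) * wordT q l.reverse) * gen q i) := by
            simp only [mul_assoc]
        _ = (-1) ^ (l.length + 1) := by
            rw [ih.1, hc, ← mul_assoc, hashGen_mul_gen, pow_succ, ← hc, mul_neg_one]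
    · calc wordT q l.reverse * gen q i * (hashGen q i * hash q (wordT q l))
          = wordT q l.reverse * (gen q i * hashGen q i) * hash q (wordT q l) := by
            simp only [mul_assoc]
        _ = (-1) ^ (l.length + 1) := by
            rw [gen_mul_hashGen, mul_neg_one, neg_mul, ih.2, pow_succ, mul_neg_one]

variable (n) in
/-- The alternating Hecke algebra: the fixed-point subalgebra of `#`. -/
def Alt : Subalgebra R (Hecke q n) := AlgHom.equalizer (hash q).toAlgHom (AlgHom.id R _)

end Hecke

/-! ### The elements `A_w` -/

section AElements

variable {F : Type*} [Field F] (q : Fˣ) {n : ℕ}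

/-- `A_w = ½ (T_w + ε_w T_w^#)`, with `ε_w = (-1)^{ℓ(w)}`. -/
def A (w : Equiv.Perm (Fin n)) : Hecke q n :=
  (2⁻¹ : F) • (T q w + (-1 : F) ^ length w • hash q (T q w))

theorem sign_wordPerm (l : List (Fin (n - 1))) :
    Equiv.Perm.sign (wordPerm l) = (-1) ^ l.length := by
  induction l with
  | nil => simp [wordPerm]
  | cons i l ih =>
    have e : wordPerm (i :: l) = s i * wordPerm l := by simp [wordPerm]
    have hne : lo i ≠ hi i := by simp [lo, hi, Fin.ext_iff]
    rw [e, map_mul, ih, s, Equiv.Perm.sign_swap hne, List.length_cons, pow_succ, mul_comm]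

theorem even_length {w : Equiv.Perm (Fin n)} (hw : w ∈ alternatingGroup (Fin n)) :
    Even (length w) := by
  obtain ⟨l, rfl, hl⟩ := exists_reducedWord w
  rw [Equiv.Perm.mem_alternatingGroup, sign_wordPerm] at hw
  rw [← hl]
  by_contra h
  rw [Nat.not_even_iff_odd] at h
  rw [h.neg_one_pow] at hw
  exact absurd hw (by decide)

theorem A_mem_Alt {w : Equiv.Perm (Fin n)} (hw : w ∈ alternatingGroup (Fin n)) :
    A q w ∈ Alt q n := by
  change hash q (A q w) = A q w
  rw [A, (even_length hw).neg_one_pow, one_smul, map_smul, map_add, hash_hash, add_comm]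

/-- For an even permutation `w`, the element `A_w` of the alternating Hecke algebra. -/
def altA (w : alternatingGroup (Fin n)) : Alt q n := ⟨A q w.1, A_mem_Alt q w.2⟩

end AElements

/-! ### Right modules and characters

A right module over an `F`-algebra `B` on a vector space `V` is an algebra homomorphism
`B → End(V)ᵒᵖ`. -/

section Characters

variable {F : Type*} [Field F] {B : Type*} [Ring B] [Algebra F B]
  {V : Type*} [AddCommGroup V] [Module F V]

/-- The character of a right module. -/
def character (M : B →ₐ[F] (Module.End F V)ᵐᵒᵖ) (b : B) : F :=
  LinearMap.trace F V (M b).unop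

/-- Restriction of a right module to a subalgebra. -/
def res (C : Subalgebra F B) (M : B →ₐ[F] (Module.End F V)ᵐᵒᵖ) : C →ₐ[F] (Module.End F V)ᵐᵒᵖ :=
  M.comp C.val

end Characters

/-! ### `q`-integers and square roots -/

section QInt

variable {F : Type*} [Field F]

/-- The `q`-integer: `[k] = q + q³ + ⋯ + q^{2k-1}` for `k ≥ 0` and
`[-k] = -(q⁻¹ + q⁻³ + ⋯ + q^{-(2k-1)})` for `k > 0`. -/
def qInt (q : Fˣ) : ℤ → F
  | Int.ofNat k => ∑ j ∈ Finset.range k, (q : F) ^ (2 * j + 1)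
  | Int.negSucc k => -∑ j ∈ Finset.range (k + 1), ((q⁻¹ : Fˣ) : F) ^ (2 * j + 1)

/-- The standing assumption on the field: `[1], …, [n]` are non-zero, and `-1, [1], …, [n]` have
square roots, a choice of which is fixed. (The value `sqrtQ k` is irrelevant unless
`1 ≤ k ≤ n`.) -/
structure SquareRoots (q : Fˣ) (n : ℕ) where
  /-- `√-1` -/
  sqrtNegOne : F
  /-- `√[k]` -/
  sqrtQ : ℕ → F
  sqrtNegOne_sq : sqrtNegOne ^ 2 = -1
  sqrtQ_sq : ∀ k : ℕ, 1 ≤ k → k ≤ n → sqrtQ k ^ 2 = qInt q k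
  qInt_ne_zero : ∀ k : ℕ, 1 ≤ k → k ≤ n → qInt q k ≠ 0

/-- `α_k = √-1 √[k+1] √[k-1] / [k]` for `k > 0`, and `α_{-k} = -α_k`. It is only used for
`2 ≤ |k| < n`. -/
def alpha {q : Fˣ} {n : ℕ} (D : SquareRoots q n) : ℤ → F
  | Int.ofNat k => D.sqrtNegOne * D.sqrtQ (k + 1) * D.sqrtQ (k - 1) / qInt q k
  | Int.negSucc k =>
      -(D.sqrtNegOne * D.sqrtQ (k + 1 + 1) * D.sqrtQ (k + 1 - 1) / qInt q (k + 1 : ℕ))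

end QInt

/-! ### Standard tableaux -/

section Tableaux

variable {μ : YoungDiagram} {n : ℕ}

/-- A bijective tableau `t` is standard if its entries increase along rows and down columns. -/
def IsStandard (t : μ.cells ≃ Fin n) : Prop :=
  ∀ x y : μ.cells, x ≠ y → x.1.1 ≤ y.1.1 → x.1.2 ≤ y.1.2 → t x < t y

variable (μ n) in
/-- The set of standard `μ`-tableaux with entries in `Fin n`. -/
structure Std : Type where
  /-- the underlying bijection -/
  tab : μ.cells ≃ Fin n
  isStandard : IsStandard tab

/-- The content (column minus row) of the entry `k` in `t`. -/
def content (t : μ.cells ≃ Fin n) (k : Fin n) : ℤ :=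
  ((t.symm k).1.2 : ℤ) - ((t.symm k).1.1 : ℤ)

/-- The axial distance from `i` to `i + 1` in `t`. -/
def axial (t : μ.cells ≃ Fin n) (i : Fin (n - 1)) : ℤ :=
  content t (lo i) - content t (hi i)

/-- The tableau `t s_i`, obtained from `t` by exchanging the entries `i` and `i + 1`. -/
def act (t : μ.cells ≃ Fin n) (i : Fin (n - 1)) : μ.cells ≃ Fin n := t.trans (s i)

/-! Combinatorial facts behind the seminormal action. -/

theorem act_apply (t : μ.cells ≃ Fin n) (i : Fin (n - 1)) (x : μ.cells) :
    act t i x = s i (t x) := rfl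

theorem act_act (t : μ.cells ≃ Fin n) (i : Fin (n - 1)) : act (act t i) i = t := by
  ext x
  simp [act, s]

theorem content_act (t : μ.cells ≃ Fin n) (i : Fin (n - 1)) (k : Fin n) :
    content (act t i) k = content t (s i k) := by
  simp [content, act, s]

theorem axial_act (t : μ.cells ≃ Fin n) (i : Fin (n - 1)) : axial (act t i) i = -axial t i := by
  simp [axial, content_act, s]

theorem IsStandard.le_of_le {t : μ.cells ≃ Fin n} (ht : IsStandard t) {x y : μ.cells}
    (h1 : x.1.1 ≤ y.1.1) (h2 : x.1.2 ≤ y.1.2) : (t x).1 ≤ (t y).1 := by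
  by_cases h : x = y
  · rw [h]
  · exact (ht x y h h1 h2).le

theorem IsStandard.lt_of {t : μ.cells ≃ Fin n} (ht : IsStandard t) {x y : μ.cells}
    (h1 : x.1.1 ≤ y.1.1) (h2 : x.1.2 ≤ y.1.2) (h3 : x.1.1 < y.1.1 ∨ x.1.2 < y.1.2) :
    (t x).1 < (t y).1 := by
  refine ht x y ?_ h1 h2
  rintro rfl
  omega

/-- Two distinct entries on one diagonal differ by at least three. -/
theorem IsStandard.content_ne {t : μ.cells ≃ Fin n} (ht : IsStandard t) {k l : Fin n}
    (hkl : k.1 < l.1) (hlk : l.1 ≤ k.1 + 2) : content t k ≠ content t l := by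
  intro h
  obtain ⟨x, rfl⟩ := t.surjective k
  obtain ⟨y, rfl⟩ := t.surjective l
  obtain ⟨⟨r, c⟩, hx⟩ := x
  obtain ⟨⟨r', c'⟩, hy⟩ := y
  simp only [content, Equiv.symm_apply_apply] at h
  have hr : r < r' := by
    by_contra hr
    have := ht.le_of_le (x := ⟨(r', c'), hy⟩) (y := ⟨(r, c), hx⟩) (by simp; omega) (by simp; omega)
    omega
  have m1 : (r + 1, c) ∈ μ.cells :=
    (μ.mem_cells _).2 (μ.up_left_mem (by omega) (by omega) ((μ.mem_cells _).1 hy))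
  have m2 : (r, c + 1) ∈ μ.cells :=
    (μ.mem_cells _).2 (μ.up_left_mem (by omega) (by omega) ((μ.mem_cells _).1 hy))
  have a1 := ht.lt_of (x := ⟨(r, c), hx⟩) (y := ⟨_, m1⟩) (by simp) (by simp) (by simp)
  have a2 := ht.lt_of (x := ⟨(r, c), hx⟩) (y := ⟨_, m2⟩) (by simp) (by simp) (by simp)
  have a3 := ht.lt_of (x := ⟨_, m1⟩) (y := ⟨(r', c'), hy⟩) (by simp; omega) (by simp; omega)
    (by simp; omega)
  have a4 := ht.lt_of (x := ⟨_, m2⟩) (y := ⟨(r', c'), hy⟩) (by simp; omega) (by simp; omega)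
    (by simp; omega)
  have ne : (t ⟨_, m1⟩).1 ≠ (t ⟨_, m2⟩).1 := by
    intro h
    have := t.injective (Fin.ext h)
    simp at this
  omega

theorem axial_ne_zero {t : μ.cells ≃ Fin n} (ht : IsStandard t) (i : Fin (n - 1)) :
    axial t i ≠ 0 := by
  rw [axial, sub_ne_zero]
  exact ht.content_ne (by simp [lo, hi]) (by simp [lo, hi])

theorem content_sub_lt (t : μ.cells ≃ Fin n) (k l : Fin n) : content t k - content t l < n := by
  obtain ⟨x, rfl⟩ := t.surjective k
  obtain ⟨y, rfl⟩ := t.surjective l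
  obtain ⟨⟨r, c⟩, hx⟩ := x
  obtain ⟨⟨r', c'⟩, hy⟩ := y
  simp only [content, Equiv.symm_apply_apply]
  have hmem : ∀ m : Fin (c + r' + 1),
      (if m.1 ≤ c then (0, m.1) else (m.1 - c, 0) : ℕ × ℕ) ∈ μ.cells := by
    intro m
    rw [μ.mem_cells]
    split_ifs with h
    · exact μ.up_left_mem (Nat.zero_le _) h ((μ.mem_cells _).1 hx)
    · exact μ.up_left_mem (by omega) (Nat.zero_le _) ((μ.mem_cells _).1 hy)
  have hinj : Function.Injective (fun m ↦ t ⟨_, hmem m⟩) := by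
    intro m m' h
    have h' := t.injective h
    simp only [Subtype.mk.injEq] at h'
    ext
    split_ifs at h' <;> simp only [Prod.mk.injEq] at h' <;> omega
  have := Fintype.card_le_of_injective _ hinj
  simp only [Fintype.card_fin] at this
  omega

theorem s_apply_val (i : Fin (n - 1)) (k : Fin n) :
    (s i k).1 = if k.1 = i.1 then i.1 + 1 else if k.1 = i.1 + 1 then i.1 else k.1 := by
  simp only [s, Equiv.swap_apply_def, Fin.ext_iff, lo, hi]
  split_ifs <;> simp_all

/-- Exchanging `i` and `i + 1` in a standard tableau gives a standard tableau exactly if the axial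
distance is not `±1`. -/
theorem isStandard_act_iff {t : μ.cells ≃ Fin n} (ht : IsStandard t) (i : Fin (n - 1)) :
    IsStandard (act t i) ↔ axial t i ≠ 1 ∧ axial t i ≠ -1 := by
  obtain ⟨x, hx⟩ := t.surjective (lo i)
  obtain ⟨y, hy⟩ := t.surjective (hi i)
  have hax : axial t i = ((x.1.2 : ℤ) - x.1.1) - ((y.1.2 : ℤ) - y.1.1) := by
    simp [axial, content, ← hx, ← hy]
  have hxv : (t x).1 = i.1 := by rw [hx]; rfl
  have hyv : (t y).1 = i.1 + 1 := by rw [hy]; rfl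
  constructor
  · intro hs
    have key : ¬ (x.1.1 ≤ y.1.1 ∧ x.1.2 ≤ y.1.2) := by
      rintro ⟨h1, h2⟩
      have := hs.le_of_le h1 h2
      rw [act_apply, act_apply, s_apply_val, s_apply_val, hxv, hyv] at this
      simp at this
    have key2 : ¬ (y.1.1 ≤ x.1.1 ∧ y.1.2 ≤ x.1.2) := by
      rintro ⟨h1, h2⟩
      have := ht.le_of_le h1 h2
      omega
    omega
  · rintro ⟨h1, h2⟩ a b hab hr hc
    have hlt : (t a).1 < (t b).1 := ht a b hab hr hc
    rw [Fin.lt_def, act_apply, act_apply, s_apply_val, s_apply_val]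
    by_cases hcase : (t a).1 = i.1 ∧ (t b).1 = i.1 + 1
    · exfalso
      obtain rfl : a = x := t.injective (Fin.ext (by omega))
      obtain rfl : b = y := t.injective (Fin.ext (by omega))
      have hne : ¬ (a.1.1 = b.1.1 ∧ a.1.2 = b.1.2) := fun h ↦
        hab (Subtype.ext (Prod.ext h.1 h.2))
      -- a cell strictly between the two
      obtain ⟨z, z1, z2, z3, z4, z5, z6⟩ : ∃ z : μ.cells, a.1.1 ≤ z.1.1 ∧ a.1.2 ≤ z.1.2 ∧
          z.1.1 ≤ b.1.1 ∧ z.1.2 ≤ b.1.2 ∧ (a.1.1 < z.1.1 ∨ a.1.2 < z.1.2) ∧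
          (z.1.1 < b.1.1 ∨ z.1.2 < b.1.2) := by
        have hb : (b.1.1, b.1.2) ∈ μ := (μ.mem_cells _).1 b.2
        by_cases h : a.1.1 < b.1.1
        · refine ⟨⟨(a.1.1 + 1, a.1.2), (μ.mem_cells _).2 (μ.up_left_mem h hc hb)⟩, ?_⟩
          simp only
          omega
        · refine ⟨⟨(a.1.1, a.1.2 + 1), (μ.mem_cells _).2
            (μ.up_left_mem hr (by omega) hb)⟩, ?_⟩
          simp only
          omega
      have c1 := ht.lt_of z1 z2 z5
      have c2 := ht.lt_of z3 z4 z6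
      omega
    · split_ifs <;> omega

end Tableaux

/-! ### The Specht modules in seminormal form -/

section Specht

variable {F : Type*} [Field F] {q : Fˣ} {n : ℕ}

/-- The vector space `S(μ)` with basis `v_t = Finsupp.single t 1`, for `t` a standard
`μ`-tableau. -/
abbrev SpechtSpace (F : Type*) [Field F] (μ : YoungDiagram) (n : ℕ) : Type _ := Std μ n →₀ F

open Classical in
/-- The operator `v_t ↦ -1/[ρ_t(i)] v_t + α_t(i) v_{t s_i}`, where `α_t(i)` is `α_{ρ_t(i)}` if
`t s_i` is standard and the second term is absent otherwise. -/
def spechtOp (D : SquareRoots q n) (μ : YoungDiagram) (i : Fin (n - 1)) :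
    Module.End F (SpechtSpace F μ n) :=
  Finsupp.linearCombination F fun t : Std μ n ↦
    (-1 / qInt q (axial t.tab i)) • Finsupp.single t (1 : F) +
      if h : IsStandard (act t.tab i) then
        alpha D (axial t.tab i) • Finsupp.single (⟨act t.tab i, h⟩ : Std μ n) (1 : F)
      else 0

/-! The relations of the Hecke algebra hold for these operators. -/

theorem qInt_succ (q : Fˣ) (k : ℤ) : qInt q (k + 1) = qInt q k + ((q ^ (2 * k + 1) : Fˣ) : F) := by
  rcases k with k | k
  · have : (Int.ofNat k + 1 : ℤ) = Int.ofNat (k + 1) := rfl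
    rw [this, qInt, qInt, Finset.sum_range_succ]
    rw [show (2 * Int.ofNat k + 1 : ℤ) = ((2 * k + 1 : ℕ) : ℤ) by simp, zpow_natCast]
    simp
  · rw [show (2 * Int.negSucc k + 1 : ℤ) = -((2 * k + 1 : ℕ) : ℤ) by
      rw [Int.negSucc_eq]; push_cast; ring, zpow_neg, zpow_natCast]
    rcases k with k | k
    · simp [qInt]
    · have : (Int.negSucc (k + 1) + 1 : ℤ) = Int.negSucc k := rfl
      rw [this, qInt, qInt, Finset.sum_range_succ _ (k + 1)]
      simp

theorem qInt_zero (q : Fˣ) : qInt q 0 = 0 := by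
  change qInt q (Int.ofNat 0) = 0
  simp [qInt]

theorem qInt_mul (q : Fˣ) (k : ℤ) :
    1 + ((q : F) - (q : F)⁻¹) * qInt q k = ((q ^ (2 * k) : Fˣ) : F) := by
  have hq : (q : F) ≠ 0 := q.ne_zero
  have step : ∀ k : ℤ, ((q : F) - (q : F)⁻¹) * ((q ^ (2 * k + 1) : Fˣ) : F) =
      ((q ^ (2 * (k + 1)) : Fˣ) : F) - ((q ^ (2 * k) : Fˣ) : F) := by
    intro k
    rw [mul_add, zpow_add, zpow_add]
    push_cast
    field_simp
  induction k using Int.induction_on with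
  | zero => simp [qInt_zero]
  | succ k ih =>
    rw [qInt_succ, mul_add, step, ← ih]; ring
  | pred k ih =>
    have h1 := qInt_succ q (-(k : ℤ) - 1)
    have h2 := step (-(k : ℤ) - 1)
    rw [sub_add_cancel] at h1 h2
    rw [h1, mul_add, h2] at ih
    linear_combination ih

theorem qInt_add (q : Fˣ) (x y : ℤ) :
    qInt q (x + y) = qInt q x + ((q ^ (2 * x) : Fˣ) : F) * qInt q y := by
  induction y using Int.induction_on with
  | zero => simp [qInt_zero]
  | succ k ih =>
    rw [← add_assoc, qInt_succ, ih, qInt_succ, mul_add (((q ^ (2 * x) : Fˣ) : F)),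
      show 2 * (x + (k : ℤ)) + 1 = 2 * x + (2 * k + 1) by ring, zpow_add]
    push_cast; ring
  | pred k ih =>
    have h1 := qInt_succ q (-(k : ℤ) - 1)
    have h2 := qInt_succ q (x + (-(k : ℤ) - 1))
    rw [sub_add_cancel] at h1
    rw [show x + (-(k : ℤ) - 1) + 1 = x + -k by ring,
      show 2 * (x + (-(k : ℤ) - 1)) + 1 = 2 * x + (2 * (-k - 1) + 1) by ring, zpow_add,
      ih, h1] at h2
    push_cast at h2 ⊢
    linear_combination -h2

theorem qInt_neg (q : Fˣ) (x : ℤ) :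
    qInt q (-x) = -qInt q x / (1 + ((q : F) - (q : F)⁻¹) * qInt q x) := by
  have h := qInt_add q x (-x)
  rw [add_neg_cancel, qInt_zero] at h
  have hu : ((q ^ (2 * x) : Fˣ) : F) ≠ 0 := Units.ne_zero _
  rw [qInt_mul, eq_div_iff hu]
  linear_combination -h

theorem SquareRoots.qInt_ne (D : SquareRoots q n) {x : ℤ} (hx : x ≠ 0) (h1 : x < n) (h2 : -x < n) :
    qInt q x ≠ 0 := by
  have pos : ∀ m : ℤ, 0 < m → m < n → qInt q m ≠ 0 := by
    intro m hm hmn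
    obtain ⟨k, rfl⟩ := Int.eq_ofNat_of_zero_le hm.le
    exact D.qInt_ne_zero k (by omega) (by omega)
  rcases lt_or_gt_of_ne hx with h | h
  · have hp := pos (-x) (by omega) h2
    intro h0
    apply hp
    rw [qInt_neg, h0]
    simp
  · exact pos x h h1

/-- `α_k` with value zero for `k = ±1`. -/
def alpha0 (D : SquareRoots q n) (k : ℤ) : F := if k = 1 ∨ k = -1 then 0 else alpha D k

theorem alpha_neg (D : SquareRoots q n) {k : ℕ} (hk : 0 < k) :
    alpha D (-(k : ℤ)) = -alpha D k := by
  obtain ⟨m, rfl⟩ := Nat.exists_eq_succ_of_ne_zero hk.ne'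
  rfl

theorem alpha0_mul_nat (D : SquareRoots q n) {k : ℕ} (hk : 0 < k) (hkn : k < n) :
    alpha0 D k * alpha0 D (-(k : ℤ)) =
      1 - (1 + ((q : F) - (q : F)⁻¹) * qInt q k) / qInt q k ^ 2 := by
  have hq : (q : F) ≠ 0 := q.ne_zero
  have hX := D.qInt_ne_zero k (by omega) (by omega)
  by_cases h1 : k = 1
  · subst h1
    have : qInt q ((1 : ℕ) : ℤ) = q := by
      change qInt q (Int.ofNat 1) = _
      simp [qInt]
    rw [this, alpha0, if_pos (by simp)]
    field_simp
    ring
  · rw [alpha0, alpha0, if_neg (by omega), if_neg (by omega), alpha_neg D hk]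
    have e : alpha D (k : ℤ) = D.sqrtNegOne * D.sqrtQ (k + 1) * D.sqrtQ (k - 1) / qInt q k := rfl
    have s1 := D.sqrtQ_sq (k + 1) (by omega) (by omega)
    have s2 := D.sqrtQ_sq (k - 1) (by omega) (by omega)
    have s0 := D.sqrtNegOne_sq
    have a1 := qInt_succ q (k : ℤ)
    have a2 := qInt_succ q ((k : ℤ) - 1)
    have m := qInt_mul q (k : ℤ)
    rw [show 2 * ((k : ℤ) - 1) + 1 = 2 * k + (-1) by ring, zpow_add, sub_add_cancel] at a2
    rw [zpow_add] at a1
    push_cast [Nat.cast_sub (show 1 ≤ k by omega)] at s1 s2 a1 a2 m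
    rw [← m, zpow_one] at a1
    rw [← m, zpow_neg_one] at a2
    rw [a1] at s1
    have s2' : D.sqrtQ (k - 1) ^ 2 = qInt q (k : ℤ) -
        (1 + ((q : F) - (q : F)⁻¹) * qInt q k) * (q : F)⁻¹ := by
      rw [s2]; linear_combination -a2
    rw [e]
    generalize qInt q (k : ℤ) = X at *
    rw [show D.sqrtNegOne * D.sqrtQ (k + 1) * D.sqrtQ (k - 1) / X *
        -(D.sqrtNegOne * D.sqrtQ (k + 1) * D.sqrtQ (k - 1) / X) =
        -(D.sqrtNegOne ^ 2 * D.sqrtQ (k + 1) ^ 2 * D.sqrtQ (k - 1) ^ 2 / X ^ 2) by ring,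
      s0, s1, s2']
    field_simp
    ring

theorem alpha0_mul (D : SquareRoots q n) {k : ℤ} (hk : k ≠ 0) (h1 : k < n) (h2 : -k < n) :
    alpha0 D k * alpha0 D (-k) =
      1 - (1 + ((q : F) - (q : F)⁻¹) * qInt q k) / qInt q k ^ 2 := by
  rcases lt_or_gt_of_ne hk with h | h
  · obtain ⟨m, hm⟩ := Int.eq_ofNat_of_zero_le (show 0 ≤ -k by omega)
    obtain rfl : k = -(m : ℤ) := by omega
    have e := alpha0_mul_nat D (k := m) (by omega) (by omega)
    have hX := D.qInt_ne_zero m (by omega) (by omega)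
    have hu : 1 + ((q : F) - (q : F)⁻¹) * qInt q m ≠ 0 := by
      rw [qInt_mul]; exact Units.ne_zero _
    rw [neg_neg, mul_comm, e, qInt_neg]
    generalize qInt q (m : ℤ) = X at *
    generalize (q : F) - (q : F)⁻¹ = d at *
    field_simp
    ring
  · obtain ⟨m, rfl⟩ := Int.eq_ofNat_of_zero_le h.le
    exact alpha0_mul_nat D (by omega) (by omega)

variable {μ : YoungDiagram}

open Classical in
/-- The basis vector `v_t`, extended by zero to all bijective tableaux. -/
def vec (F : Type*) [Field F] (t : μ.cells ≃ Fin n) : SpechtSpace F μ n :=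
  if h : IsStandard t then Finsupp.single (⟨t, h⟩ : Std μ n) 1 else 0

theorem spechtOp_vec (D : SquareRoots q n) (i : Fin (n - 1)) (t : μ.cells ≃ Fin n) :
    spechtOp D μ i (vec F t) =
      (-1 / qInt q (axial t i)) • vec F t + alpha0 D (axial t i) • vec F (act t i) := by
  by_cases ht : IsStandard t
  · rw [vec, dif_pos ht, spechtOp, Finsupp.linearCombination_single, one_smul]
    by_cases h : IsStandard (act t i)
    · have h' := (isStandard_act_iff ht i).1 h
      rw [dif_pos h, vec, dif_pos h, alpha0, if_neg (by tauto)]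
    · have h' := mt (isStandard_act_iff ht i).2 h
      rw [dif_neg h, vec, dif_neg h, smul_zero]
  · have hv : vec F t = 0 := by rw [vec, dif_neg ht]
    rw [hv, map_zero, smul_zero, zero_add]
    by_cases h : IsStandard (act t i)
    · have h' := mt (isStandard_act_iff h i).2 (by rwa [act_act])
      rw [axial_act] at h'
      rw [alpha0, if_pos (by omega), zero_smul]
    · rw [vec, dif_neg h, smul_zero]

theorem end_ext {f g : Module.End F (SpechtSpace F μ n)}
    (h : ∀ t : μ.cells ≃ Fin n, IsStandard t → f (vec F t) = g (vec F t)) : f = g := by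
  apply Finsupp.lhom_ext'
  rintro ⟨t, ht⟩
  apply LinearMap.ext_ring
  have := h t ht
  rw [vec, dif_pos ht] at this
  exact this

theorem spechtOp_quadratic (D : SquareRoots q n) (i : Fin (n - 1)) :
    spechtOp D μ i * spechtOp D μ i =
      ((q : F) - (q : F)⁻¹) • spechtOp D μ i + 1 := by
  apply end_ext
  intro t ht
  have h0 := axial_ne_zero ht i
  have h1 : axial t i < n := content_sub_lt t _ _
  have h2 : -axial t i < n := by rw [axial, neg_sub]; exact content_sub_lt t _ _
  have hX := D.qInt_ne h0 h1 h2
  have hα := alpha0_mul D h0 h1 h2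
  have hu : 1 + ((q : F) - (q : F)⁻¹) * qInt q (axial t i) ≠ 0 := by
    rw [qInt_mul]; exact Units.ne_zero _
  simp only [Module.End.mul_apply, LinearMap.add_apply, LinearMap.smul_apply, Module.End.one_apply,
    spechtOp_vec, map_add, map_smul, act_act, axial_act, qInt_neg]
  generalize vec F t = v
  generalize vec F (act t i) = w
  generalize qInt q (axial t i) = X at *
  generalize alpha0 D (axial t i) = a at *
  generalize alpha0 D (-axial t i) = b at *
  generalize (q : F) - (q : F)⁻¹ = d at *
  have e1 : (-1 / X) * (-1 / X) + a * b = d * (-1 / X) + 1 := by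
    rw [hα]; field_simp; ring
  have e2 : (-1 / X) * a + a * (-1 / (-X / (1 + d * X))) = d * a := by
    field_simp; ring
  linear_combination (norm := module) e1 • v + e2 • w

theorem s_comm {i j : Fin (n - 1)} (h : i.1 + 1 < j.1) (k : Fin n) :
    s i (s j k) = s j (s i k) := by
  apply Fin.ext
  rw [s_apply_val, s_apply_val, s_apply_val, s_apply_val]
  generalize i.1 = i' at *
  generalize j.1 = j' at *
  generalize k.1 = k'
  rcases lt_trichotomy k' i' with h1 | rfl | h1
  · simp [show k' ≠ i' by omega, show k' ≠ i' + 1 by omega, show k' ≠ j' by omega,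
      show k' ≠ j' + 1 by omega]
  · grind
  · grind

theorem s_braid {i j : Fin (n - 1)} (h : i.1 + 1 = j.1) (k : Fin n) :
    s i (s j (s i k)) = s j (s i (s j k)) := by
  apply Fin.ext
  simp only [s_apply_val, ← h]
  generalize i.1 = i'
  generalize k.1 = k'
  grind

theorem spechtOp_commute (D : SquareRoots q n) (i j : Fin (n - 1)) (h : i.1 + 1 < j.1) :
    spechtOp D μ i * spechtOp D μ j = spechtOp D μ j * spechtOp D μ i := by
  apply end_ext
  intro t _
  have e1 : act (act t i) j = act (act t j) i := by
    ext x; simp only [act_apply, s_comm h]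
  have f : ∀ (i j : Fin (n - 1)), (i.1 + 1 < j.1 ∨ j.1 + 1 < i.1) →
      axial (act t i) j = axial t j := by
    intro i j h
    have a1 : s i (lo j) = lo j := by ext; simp only [s_apply_val, lo]; split_ifs <;> omega
    have a2 : s i (hi j) = hi j := by ext; simp only [s_apply_val, hi]; split_ifs <;> omega
    rw [axial, content_act, content_act, a1, a2, axial]
  simp only [Module.End.mul_apply, spechtOp_vec, map_add, map_smul, e1, f i j (Or.inl h),
    f j i (Or.inr h)]
  module

theorem spechtOp_braid (D : SquareRoots q n) (i j : Fin (n - 1)) (h : i.1 + 1 = j.1) :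
    spechtOp D μ i * spechtOp D μ j * spechtOp D μ i =
      spechtOp D μ j * spechtOp D μ i * spechtOp D μ j := by
  apply end_ext
  intro t ht
  have e1 : act (act (act t i) j) i = act (act (act t j) i) j := by
    ext x; simp only [act_apply, s_braid h]
  have hij : lo j = hi i := Fin.ext h.symm
  have b1 : s i (lo i) = hi i := Equiv.swap_apply_left _ _
  have b2 : s i (hi i) = lo i := Equiv.swap_apply_right _ _
  have b3 : s i (hi j) = hi j := by ext; simp only [s_apply_val, hi]; split_ifs <;> omega
  have b4 : s j (lo i) = lo i := by ext; simp only [s_apply_val, lo]; split_ifs <;> omega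
  have b5 : s j (hi i) = hi j := by rw [← hij]; exact Equiv.swap_apply_left _ _
  have b6 : s j (hi j) = hi i := by rw [← hij]; exact Equiv.swap_apply_right _ _
  have hx0 : content t (lo i) - content t (hi i) ≠ 0 := axial_ne_zero ht i
  have hy0 : content t (hi i) - content t (hi j) ≠ 0 := by
    have := axial_ne_zero ht j
    rwa [axial, hij] at this
  have hz0 : content t (lo i) - content t (hi j) ≠ 0 :=
    sub_ne_zero.2 (ht.content_ne (by simp [lo, hi]; omega) (by simp [lo, hi]; omega))
  have c1 := content_sub_lt t (lo i) (hi i)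
  have c2 := content_sub_lt t (hi i) (lo i)
  have c3 := content_sub_lt t (hi i) (hi j)
  have c4 := content_sub_lt t (hi j) (hi i)
  have c5 := content_sub_lt t (lo i) (hi j)
  have c6 := content_sub_lt t (hi j) (lo i)
  have hX := D.qInt_ne hx0 c1 (by omega)
  have hY := D.qInt_ne hy0 c3 (by omega)
  have hZ := D.qInt_ne hz0 c5 (by omega)
  have hα := alpha0_mul D hx0 c1 (by omega)
  have hβ := alpha0_mul D hy0 c3 (by omega)
  have hzz := qInt_add q (content t (lo i) - content t (hi i)) (content t (hi i) - content t (hi j))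
  rw [← qInt_mul, sub_add_sub_cancel] at hzz
  have hux : 1 + ((q : F) - (q : F)⁻¹) * qInt q (content t (lo i) - content t (hi i)) ≠ 0 := by
    rw [qInt_mul]; exact Units.ne_zero _
  have huy : 1 + ((q : F) - (q : F)⁻¹) * qInt q (content t (hi i) - content t (hi j)) ≠ 0 := by
    rw [qInt_mul]; exact Units.ne_zero _
  have nx := qInt_neg q (content t (lo i) - content t (hi i))
  have ny := qInt_neg q (content t (hi i) - content t (hi j))
  rw [neg_sub] at nx ny hα hβ
  simp only [Module.End.mul_apply, spechtOp_vec, map_add, map_smul, act_act, e1, axial,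
    content_act, hij, b1, b2, b3, b4, b5, b6]
  rw [nx, ny]
  generalize vec F t = v0
  generalize vec F (act t i) = v1
  generalize vec F (act t j) = v2
  generalize vec F (act (act t i) j) = v3
  generalize vec F (act (act t j) i) = v4
  generalize vec F (act (act (act t j) i) j) = v5
  generalize qInt q (content t (lo i) - content t (hi i)) = X at *
  generalize qInt q (content t (hi i) - content t (hi j)) = Y at *
  generalize qInt q (content t (lo i) - content t (hi j)) = Z at *
  generalize alpha0 D (content t (lo i) - content t (hi i)) = a at *
  generalize alpha0 D (content t (hi i) - content t (lo i)) = a' at *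
  generalize alpha0 D (content t (hi i) - content t (hi j)) = b at *
  generalize alpha0 D (content t (hi j) - content t (hi i)) = b' at *
  generalize alpha0 D (content t (lo i) - content t (hi j)) = c at *
  generalize (q : F) - (q : F)⁻¹ = d at *
  have k0 : (-1 / X) * (-1 / Y) * (-1 / X) + a * a' * (-1 / Z) =
      (-1 / Y) * (-1 / X) * (-1 / Y) + b * b' * (-1 / Z) := by
    rw [hα, hβ]; field_simp; rw [hzz]; ring
  have k1 : (-1 / X) * (-1 / Y) * a + a * (-1 / Z) * (-1 / (-X / (1 + d * X))) =
      (-1 / Y) * a * (-1 / Z) := by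
    field_simp; rw [hzz]; ring
  have k2 : (-1 / Y) * (-1 / X) * b + b * (-1 / Z) * (-1 / (-Y / (1 + d * Y))) =
      (-1 / X) * b * (-1 / Z) := by
    field_simp; rw [hzz]; ring
  linear_combination (norm := module) k0 • v0 + k1 • v1 - k2 • v2

/-- The Specht module `S(μ)`: the right module of the Hecke algebra on which the generator `T_i`
acts by `spechtOp D μ i`. -/
def specht (D : SquareRoots q n) (μ : YoungDiagram) :
    Hecke q n →ₐ[F] (Module.End F (SpechtSpace F μ n))ᵐᵒᵖ :=
  lift q (fun i ↦ MulOpposite.op (spechtOp D μ i))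
    (by
      intro i
      have h := spechtOp_quadratic (μ := μ) D i
      have hq : (q : F) ≠ 0 := q.ne_zero
      apply MulOpposite.unop_injective
      apply LinearMap.ext
      intro v
      have hv := congrArg (fun f ↦ f v) h
      simp only [Module.End.mul_apply, LinearMap.add_apply, LinearMap.smul_apply,
        Module.End.one_apply] at hv
      simp only [MulOpposite.unop_mul, MulOpposite.unop_sub, MulOpposite.unop_add,
        MulOpposite.unop_op, MulOpposite.algebraMap_apply, Module.End.mul_apply,
        LinearMap.add_apply, LinearMap.sub_apply, Module.algebraMap_end_apply, map_sub, map_smul,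
        hv, MulOpposite.unop_zero, LinearMap.zero_apply, Units.val_inv_eq_inv_val]
      have e : (1 - (q : F) * (q : F)⁻¹) = 0 := by rw [mul_inv_cancel₀ hq, sub_self]
      linear_combination (norm := module) e • v)
    (by
      intro i j h
      rw [← MulOpposite.op_mul, ← MulOpposite.op_mul, spechtOp_commute D i j h])
    (by
      intro i j h
      simp only [← MulOpposite.op_mul, ← mul_assoc]
      rw [spechtOp_braid D i j h])

theorem specht_gen (D : SquareRoots q n) (μ : YoungDiagram) (i : Fin (n - 1)) :
    specht D μ (gen q i) = MulOpposite.op (spechtOp D μ i) :=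
  lift_gen q _ _ _ _ i

/-- The character `χ^μ` of the Specht module `S(μ)`. -/
def chi (D : SquareRoots q n) (μ : YoungDiagram) : Hecke q n → F :=
  character (specht D μ)

/-- The character of the restriction of `S(μ)` to the alternating Hecke algebra. -/
def chiAlt (D : SquareRoots q n) (μ : YoungDiagram) : Alt q n → F :=
  character (res (Alt q n) (specht D μ))

end Specht

end AltHecke

end

noncomputable section

namespace AltHecke

/-! ### Conjugate tableaux. -/

section Transpose

variable {μ : YoungDiagram} {n : ℕ}

/-! The heart of the matter is that twisting $S(\mu)$ by `#` gives $S(\mu')$, and that the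
isomorphism is simply $v_t \mapsto v_{t'}$, with $t'$ the conjugate tableau and no rescaling.

Put $d = q - q^{-1}$, so that $T_i^\# = d - T_i$, and let $\rho$ be the axial distance from $i$ to
$i+1$ in $t$. Then $T_i^\#$ sends $v_t$ to $(d + 1/[\rho])\,v_t - \alpha_\rho\, v_{ts_i}$.
Reflection in the diagonal negates contents, hence replaces $\rho$ by $-\rho$, and it commutes with
exchanging $i$ and $i+1$; so $T_i$ sends $v_{t'}$ to $-[-\rho]^{-1} v_{t'} + \alpha_{-\rho}\,
v_{(ts_i)'}$. The off-diagonal coefficients agree because $\alpha_{-\rho} = -\alpha_\rho$, and the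
diagonal ones because $[-\rho] = -[\rho]/(1 + d[\rho])$. This is `conj_spechtOp`. Both sides being
algebra homomorphisms, agreement on generators gives agreement everywhere (`specht_hash`).

Taking traces yields $\chi^\mu(x^\#) = \chi^{\mu'}(x)$ for every $x$ (`chi_hash`). For even $w$ one
has $A_w = \frac12(T_w + T_w^\#)$, and the theorem follows by linearity of the trace. -/

/-- Reflection in the diagonal, as a bijection of the cells of `μ` with those of its conjugate. -/
def cellsTranspose (μ : YoungDiagram) : μ.cells ≃ μ.transpose.cells where
  toFun x := ⟨x.1.swap, by
    rw [YoungDiagram.mem_cells, YoungDiagram.mem_transpose, Prod.swap_swap]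
    exact (μ.mem_cells _).1 x.2⟩
  invFun x := ⟨x.1.swap, (μ.mem_cells _).2
    (YoungDiagram.mem_transpose.1 ((YoungDiagram.mem_cells _).1 x.2))⟩
  left_inv _ := rfl
  right_inv _ := rfl

/-- The conjugate tableau. -/
def conjTab : (μ.cells ≃ Fin n) ≃ (μ.transpose.cells ≃ Fin n) :=
  (cellsTranspose μ).equivCongr (Equiv.refl _)

/-- Standardness is symmetric in rows and columns, which reflection exchanges; this is why the two
coordinate inequalities are passed on in swapped order. -/
theorem isStandard_conjTab_iff (t : μ.cells ≃ Fin n) : IsStandard (conjTab t) ↔ IsStandard t := by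
  constructor
  · intro h x y hxy hr hc
    exact h (cellsTranspose μ x) (cellsTranspose μ y) ((cellsTranspose μ).injective.ne hxy) hc hr
  · intro h x y hxy hr hc
    exact h ((cellsTranspose μ).symm x) ((cellsTranspose μ).symm y)
      ((cellsTranspose μ).symm.injective.ne hxy) hc hr

/-- Content is column minus row, so reflection changes its sign entry by entry. -/
theorem axial_conjTab (t : μ.cells ≃ Fin n) (i : Fin (n - 1)) :
    axial (conjTab t) i = -axial t i := by
  have h : ∀ k, content (conjTab t) k = -content t k := fun k ↦ (neg_sub _ _).symm
  rw [axial, h, h, axial]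
  ring

/-- Conjugation permutes cells while $s_i$ permutes entries: the two compose with the tableau on
opposite sides, so they commute by definition. -/
theorem act_conjTab (t : μ.cells ≃ Fin n) (i : Fin (n - 1)) :
    act (conjTab t) i = conjTab (act t i) := rfl

/-- Conjugation, as a bijection between the standard tableaux of conjugate shapes. -/
def stdTranspose (μ : YoungDiagram) (n : ℕ) : Std μ n ≃ Std μ.transpose n where
  toFun t := ⟨conjTab t.tab, (isStandard_conjTab_iff _).2 t.isStandard⟩
  invFun t := ⟨conjTab.symm t.tab, (isStandard_conjTab_iff _).1 (by
    rw [Equiv.apply_symm_apply]; exact t.isStandard)⟩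
  left_inv t := by simp
  right_inv t := by simp

/-! ### Conjugate Specht modules and the twist by `#`. -/

variable {F : Type*} [Field F] {q : Fˣ}

/-- The linear isomorphism `v_t ↦ v_{t'}` between the Specht modules of conjugate shapes. -/
def spechtTranspose (F : Type*) [Field F] (μ : YoungDiagram) (n : ℕ) :
    SpechtSpace F μ n ≃ₗ[F] SpechtSpace F μ.transpose n :=
  Finsupp.domLCongr (stdTranspose μ n)

/-- Since `vec` vanishes on non-standard tableaux and conjugation preserves standardness, the
formula holds for all bijective tableaux. Hence the term of $ts_i$ can be transported without asking
whether $ts_i$ is standard. -/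
theorem spechtTranspose_vec (t : μ.cells ≃ Fin n) :
    spechtTranspose F μ n (vec F t) = vec F (conjTab t) := by
  by_cases h : IsStandard t
  · rw [vec, dif_pos h, vec, dif_pos ((isStandard_conjTab_iff t).2 h), spechtTranspose,
      Finsupp.domLCongr_single]
    rfl
  · rw [vec, dif_neg h, vec, dif_neg (mt (isStandard_conjTab_iff t).1 h), map_zero]

/-- The sign convention for $\alpha$ is what lets $v_t \mapsto v_{t'}$ intertwine the actions
without any signs on basis vectors. The cut-off at $\pm 1$ is symmetric, so the rule survives in
`alpha0`. -/
theorem alpha0_neg (D : SquareRoots q n) {k : ℤ} (hk : k ≠ 0) : alpha0 D (-k) = -alpha0 D k := by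
  by_cases h : k = 1 ∨ k = -1
  · rw [alpha0, alpha0, if_pos h, if_pos (by omega), neg_zero]
  · rw [alpha0, alpha0, if_neg h, if_neg (by omega)]
    rcases lt_or_gt_of_ne hk with h0 | h0
    · obtain ⟨m, hm⟩ := Int.eq_ofNat_of_zero_le (show 0 ≤ -k by omega)
      obtain rfl : k = -(m : ℤ) := by omega
      rw [alpha_neg D (by omega), neg_neg, neg_neg]
    · obtain ⟨m, rfl⟩ := Int.eq_ofNat_of_zero_le h0.le
      exact alpha_neg D (by omega)

/-- The operator of `T_i` on the conjugate Specht module is that of `T_i^#` on the original. -/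
theorem conj_spechtOp (D : SquareRoots q n) (μ : YoungDiagram) (i : Fin (n - 1)) :
    (spechtTranspose F μ n).conj (((q : F) - (q : F)⁻¹) • 1 - spechtOp D μ i) =
      spechtOp D μ.transpose i := by
  apply end_ext
  intro t' ht'
  -- Every tableau of the conjugate shape is written as a conjugate, so that both sides can be
  -- expressed through the axial distance of `t`.
  obtain ⟨t, rfl⟩ := conjTab.surjective t'
  have ht := (isStandard_conjTab_iff t).1 ht'
  have h0 := axial_ne_zero ht i
  -- Axial distances lie strictly between $-n$ and $n$ and are non-zero on standard tableaux, so
  -- $[\rho]$ is invertible.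
  have hX := D.qInt_ne h0 (content_sub_lt t _ _)
    (by rw [axial, neg_sub]; exact content_sub_lt t _ _)
  -- This is $q^{2\rho}$, a unit; it is the denominator in the formula for $[-\rho]$.
  have hu : 1 + ((q : F) - (q : F)⁻¹) * qInt q (axial t i) ≠ 0 := by
    rw [qInt_mul]; exact Units.ne_zero _
  rw [LinearEquiv.conj_apply_apply, ← spechtTranspose_vec, LinearEquiv.symm_apply_apply,
    LinearMap.sub_apply, LinearMap.smul_apply, Module.End.one_apply, spechtOp_vec]
  simp only [map_sub, map_add, map_smul, spechtTranspose_vec, spechtOp_vec]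
  rw [axial_conjTab, act_conjTab, alpha0_neg D h0, qInt_neg]
  generalize vec F (conjTab t) = v
  generalize vec F (conjTab (act t i)) = u
  generalize qInt q (axial t i) = X at *
  generalize (q : F) - (q : F)⁻¹ = d at *
  -- The diagonal coefficients. Those of `u` are both $-\alpha_\rho$ already, so this is the only
  -- identity left to prove.
  have e : d - -1 / X = -1 / (-X / (1 + d * X)) := by
    field_simp
    ring
  linear_combination (norm := module) e • v

/-- Twisting the Specht module `S(μ)` by `#` gives the Specht module of the conjugate shape. -/
theorem specht_hash (D : SquareRoots q n) (μ : YoungDiagram) (x : Hecke q n) :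
    (spechtTranspose F μ n).conj (specht D μ (hash q x)).unop =
      (specht D μ.transpose x).unop := by
  -- The claim for all `x` at once is an equality of algebra homomorphisms into the opposite
  -- endomorphism algebra, conjugation by a linear isomorphism being multiplicative; so it can be
  -- checked on the generators.
  have h : ((AlgEquiv.op ((spechtTranspose F μ n).conjAlgEquiv F)).toAlgHom.comp
      ((specht D μ).comp (hash q).toAlgHom)) = specht D μ.transpose := by
    refine algHom_ext_gen (B := (Module.End F (SpechtSpace F μ.transpose n))ᵐᵒᵖ) q ?_
    intro i
    apply MulOpposite.unop_injective
    rw [specht_gen, MulOpposite.unop_op, ← conj_spechtOp]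
    change (spechtTranspose F μ n).conj (specht D μ (hash q (gen q i))).unop = _
    rw [hash_gen, hashGen, map_sub, map_smul, map_one, specht_gen, Units.val_inv_eq_inv_val]
    rfl
  exact congrArg (fun f ↦ (f x).unop) h

/-- Conjugation by a linear isomorphism preserves the trace. -/
theorem chi_hash (D : SquareRoots q n) (μ : YoungDiagram) (x : Hecke q n) :
    chi D μ (hash q x) = chi D μ.transpose x := by
  rw [chi, chi, character, character, ← specht_hash, LinearMap.trace_conj']

end Transpose

end AltHecke

end

/-! ### The character identity. -/

theorem mainTheorem8 {F : Type*} [Field F] (h2 : (2 : F) ≠ 0) (q : Fˣ) (n : ℕ) (hn : 1 ≤ n)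
    (D : AltHecke.SquareRoots q n) (μ : YoungDiagram) (hμ : μ.card = n)
    (w : alternatingGroup (Fin n)) :
    AltHecke.chiAlt D μ (AltHecke.altA q w) =
      (2 : F)⁻¹ * (AltHecke.chi D μ (AltHecke.T q w.1) +
        AltHecke.chi D μ.transpose (AltHecke.T q w.1)) := by
  -- The conjugate character at $T_w$ is replaced by $\chi^\mu(T_w^\#)$, so that only the shape `μ`
  -- remains.
  rw [← AltHecke.chi_hash]
  -- Restriction to the subalgebra is composition with the inclusion, so the restricted character at
  -- $A_w$ is by definition the full character there.
  change AltHecke.chi D μ (AltHecke.A q w.1) = _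
  -- Evenness of $w$ turns the sign in front of $T_w^\#$ into $1$; the rest is linearity.
  rw [AltHecke.A, (AltHecke.even_length w.2).neg_one_pow, one_smul]
  simp only [AltHecke.chi, AltHecke.character, map_smul, map_add, MulOpposite.unop_smul,
    MulOpposite.unop_add, smul_eq_mul]
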